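/- Let $F$ be a non-abelian free group of finite rank. Then $F$ has exponential automorphic growth. Explicitly, let $\Sigma$ be any finite generating set of $F$, write $|g|_\Sigma=\min\{n\in\mathbb{N} : g\in(\Sigma\cup\Sigma^{-1})^n\}$ for $g\in F$, and let $\alpha_{F,\Sigma}(n)$ be the number of orbits of the action of $\operatorname{Aut}(F)$ on $F$ that contain an element $g$ with $|g|_\Sigma\le n$. Then $\alpha_{F,\Sigma}\sim 2^n$. Here, for non-decreasing non-zero functions $f,g\colon\mathbb{N}\to\mathbb{N}$, $f\preccurlyeq g$ means that there is an integer $\lambda\ge 1$ with $f(n)\le\lambda g(\lambda n+\lambda)+\lambda$ for all $n\in\mathbb{N}$, and $f\sim g$ means that $f\preccurlyeq g$ and $g\preccurlyeq f$. -/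

import Mathlib

open scoped Pointwise

namespace AutGrowth

variable {G : Type*} [Group G]

/-- The word length `|g|_S = min {n | g ∈ (S ∪ S⁻¹)ⁿ}` of `g` with respect to `S`
(the set on the right is nonempty for every `g` as soon as `S` generates the group). -/
noncomputable def wordLength (S : Set G) (g : G) : ℕ :=
  sInf {n : ℕ | g ∈ (S ∪ S⁻¹) ^ n}

/-- The set `G/Ω` of orbits of `G` under a group `Ω` of automorphisms of `G`. -/
abbrev Orbits (Ω : Subgroup (MulAut G)) : Type _ :=
  MulAction.orbitRel.Quotient Ω G

/-- The length of an orbit: the least word length of one of its elements. -/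
noncomputable def orbitLength (S : Set G) {Ω : Subgroup (MulAut G)} (o : Orbits Ω) : ℕ :=
  sInf (wordLength S '' o.orbit)

/-- The (cumulative) `Ω`-automorphic growth function of `(G, S)`: the number of `Ω`-orbits of
length at most `n`. -/
noncomputable def orbitGrowth (Ω : Subgroup (MulAut G)) (S : Set G) (n : ℕ) : ℕ :=
  {o : Orbits Ω | orbitLength S o ≤ n}.ncard

/-- The automorphic growth function of `(G, S)`, the case `Ω = Aut(G)`. -/
noncomputable def automorphicGrowth (S : Set G) : ℕ → ℕ :=
  orbitGrowth (⊤ : Subgroup (MulAut G)) S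

/-- The preorder on growth functions: `f ≼ g` if for some integer `c ≥ 1`,
`f n ≤ c * g (c * n + c) + c` for all `n`. -/
def GrowthLE (f g : ℕ → ℕ) : Prop :=
  ∃ c : ℕ, c ≠ 0 ∧ ∀ n : ℕ, f n ≤ c * g (c * n + c) + c

/-- Equivalence of growth functions. -/
def GrowthEquiv (f g : ℕ → ℕ) : Prop :=
  GrowthLE f g ∧ GrowthLE g f

/-- Exponential growth: equivalence to `n ↦ 2 ^ n`. -/
def IsExponentialGrowth (f : ℕ → ℕ) : Prop :=
  GrowthEquiv f (fun n => 2 ^ n)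

/-! The growth function of a finite generating set counts finite sets of orbits, and is a
non-decreasing function that is nowhere zero. -/

theorem exists_mem_pow {S : Set G} (hS : Subgroup.closure S = ⊤) (g : G) :
    ∃ n : ℕ, g ∈ (S ∪ S⁻¹) ^ n := by
  have hg : g ∈ Submonoid.closure (S ∪ S⁻¹) := by
    rw [← Subgroup.closure_toSubmonoid, hS]
    trivial
  induction hg using Submonoid.closure_induction with
  | mem x hx => exact ⟨1, by simpa using hx⟩
  | one => exact ⟨0, by simp⟩
  | mul x y _ _ hx hy =>
    obtain ⟨m, hm⟩ := hx
    obtain ⟨n, hn⟩ := hy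
    exact ⟨m + n, by rw [pow_add]; exact Set.mul_mem_mul hm hn⟩

theorem mem_pow_wordLength {S : Set G} (hS : Subgroup.closure S = ⊤) (g : G) :
    g ∈ (S ∪ S⁻¹) ^ wordLength S g :=
  Nat.sInf_mem (s := {n : ℕ | g ∈ (S ∪ S⁻¹) ^ n}) (exists_mem_pow hS g)

theorem finite_ball {S : Set G} (hfin : S.Finite) (hS : Subgroup.closure S = ⊤) (n : ℕ) :
    {g : G | wordLength S g ≤ n}.Finite := by
  have hU : (S ∪ S⁻¹).Finite := hfin.union hfin.inv
  have hp : ∀ k : ℕ, ((S ∪ S⁻¹) ^ k).Finite := by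
    intro k
    induction k with
    | zero => simp
    | succ k ih => rw [pow_succ]; exact ih.mul hU
  refine ((Set.finite_Iic n).biUnion fun k _ => hp k).subset fun g hg => ?_
  exact Set.mem_biUnion (show wordLength S g ∈ Set.Iic n from hg) (mem_pow_wordLength hS g)

theorem finite_orbits {S : Set G} (hfin : S.Finite) (hS : Subgroup.closure S = ⊤)
    (Ω : Subgroup (MulAut G)) (n : ℕ) : {o : Orbits Ω | orbitLength S o ≤ n}.Finite := by
  refine ((finite_ball hfin hS n).image
    (Quotient.mk'' : G → MulAction.orbitRel.Quotient Ω G)).subset fun o ho => ?_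
  have hne : (wordLength S '' MulAction.orbitRel.Quotient.orbit o).Nonempty :=
    (MulAction.orbitRel.Quotient.nonempty_orbit o).image _
  obtain ⟨g, hg, hgl⟩ := Nat.sInf_mem hne
  exact ⟨g, hgl.trans_le ho, MulAction.orbitRel.Quotient.mem_orbit.mp hg⟩

theorem orbitGrowth_mono {S : Set G} (hfin : S.Finite) (hS : Subgroup.closure S = ⊤)
    (Ω : Subgroup (MulAut G)) : Monotone (orbitGrowth Ω S) := fun _ n hmn =>
  Set.ncard_le_ncard (fun _ ho => le_trans ho hmn) (finite_orbits hfin hS Ω n)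

theorem orbitGrowth_pos {S : Set G} (hfin : S.Finite) (hS : Subgroup.closure S = ⊤)
    (Ω : Subgroup (MulAut G)) (n : ℕ) : 0 < orbitGrowth Ω S n := by
  refine (Set.ncard_pos (finite_orbits hfin hS Ω n)).mpr
    ⟨(Quotient.mk'' (1 : G) : MulAction.orbitRel.Quotient Ω G), ?_⟩
  have h1 : wordLength S (1 : G) = 0 := Nat.sInf_eq_zero.mpr (Or.inl (by simp))
  refine le_trans (Nat.sInf_le (Set.mem_image_of_mem _
    (MulAction.orbitRel.Quotient.mem_orbit.mpr rfl))) (h1.trans_le n.zero_le)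

end AutGrowth

/-!
The upper bound is the count of a ball: an orbit of length at most `n` meets the ball of radius `n`,
which has at most `|S ∪ S⁻¹ ∪ {1}| ^ n` elements.

For the lower bound, let `x ≠ y` be two basis elements and let `p = ∑ aᵢ Xⁱ` be a polynomial with
natural coefficients. The element `w_p = ∏ xⁱ ⁅x, y⁆ ^ aᵢ x⁻ⁱ`, bracketed by Horner's scheme, has
length linear in `deg p` if the coefficients are bounded (`exists_wordLength_hornerWord_le`).
The growth is exponential because for the monic polynomials `p` with constant coefficient `2` and
the coefficients strictly in between equal to `0` or `1`, the elements `w_p` lie in distinct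
`Aut(F)`-orbits.

This is seen in the metabelian group of affine maps `z ↦ Tᵏ z + a` over the Laurent polynomials
`ℤ[T;T⁻¹]`. Send `x` to `z ↦ T z`, `y` to `z ↦ z + 1` and the rest of the basis to the identity.
Then `w_q` becomes the translation by `(T - 1) q(T)`. If an endomorphism of `F` maps `w_p` to `w_q`,
then composing it with this homomorphism gives another homomorphism, which sends `x` to a map of the
form `z ↦ Tᵏ z + a` and the commutator `⁅x, y⁆` to a translation by some `e`, whence
`p(Tᵏ) e = (T - 1) q(T)`. Since `p(1) ≠ 0`, the factor `T - 1` divides `e`, so `p(Tᵏ)` divides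
`q(T)` up to a power of `T`. For `k = 0` this would make `p(1) ≥ 3` divide a monic polynomial, for
`k < 0` a polynomial with leading coefficient `2` would divide a monic one, and for `k > 0` comparing
degrees leaves `k = 1` and `p = q` (`eq_of_aeval_T_mul_eq`).
-/

namespace AutGrowth

open Polynomial LaurentPolynomial
open scoped commutatorElement

/-! ### The affine group over Laurent polynomials -/

/-- The group of affine maps `z ↦ Tᵏ z + a` of `ℤ[T;T⁻¹]`, encoded by the pairs `(a, k)`, with
composition as multiplication. -/
@[ext]
structure LaurentAffine where
  /-- The translation part `a`. -/
  trans : ℤ[T;T⁻¹]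
  /-- The exponent `k` of the linear part `Tᵏ`. -/
  exp : ℤ

namespace LaurentAffine

noncomputable instance : Mul LaurentAffine :=
  ⟨fun g h => ⟨g.trans + T g.exp * h.trans, g.exp + h.exp⟩⟩

noncomputable instance : One LaurentAffine := ⟨⟨0, 0⟩⟩

noncomputable instance : Inv LaurentAffine := ⟨fun g => ⟨-(T (-g.exp) * g.trans), -g.exp⟩⟩

@[simp] theorem trans_mul (g h : LaurentAffine) :
    (g * h).trans = g.trans + T g.exp * h.trans := rfl

@[simp] theorem exp_mul (g h : LaurentAffine) : (g * h).exp = g.exp + h.exp := rfl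

@[simp] theorem trans_one : (1 : LaurentAffine).trans = 0 := rfl

@[simp] theorem exp_one : (1 : LaurentAffine).exp = 0 := rfl

@[simp] theorem trans_inv (g : LaurentAffine) : (g⁻¹).trans = -(T (-g.exp) * g.trans) := rfl

@[simp] theorem exp_inv (g : LaurentAffine) : (g⁻¹).exp = -g.exp := rfl

noncomputable instance : Group LaurentAffine := by
  refine Group.ofLeftAxioms (fun a b c => ?_) (fun a => ?_) (fun a => ?_)
  · ext1
    · simp only [trans_mul, exp_mul, T_add]
      ring
    · exact add_assoc _ _ _
  · ext1 <;> simp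
  · ext1 <;> simp

theorem exp_commutator (g h : LaurentAffine) : ⁅g, h⁆.exp = 0 := by
  simp [commutatorElement_def]

theorem pow_of_exp_eq_zero {g : LaurentAffine} (hg : g.exp = 0) (n : ℕ) :
    (g ^ n).trans = n * g.trans ∧ (g ^ n).exp = 0 := by
  induction n with
  | zero => simp
  | succ n ih =>
    obtain ⟨h1, h2⟩ := ih
    rw [pow_succ]
    simp only [trans_mul, exp_mul, h1, h2, hg, T_zero]
    exact ⟨by push_cast; ring, by simp⟩

end LaurentAffine

/-! ### Polynomials and words in Horner form -/

/-- The monic polynomial `∑ aᵢ Xⁱ + X ^ d` with lower coefficients the list `[a₀, …, a_{d-1}]`. -/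
noncomputable def hornerPoly : List ℕ → ℤ[X]
  | [] => 1
  | a :: l => (a : ℤ[X]) + X * hornerPoly l

/-- The product of the elements `xⁱ c ^ aᵢ x⁻ⁱ`, for increasing `i`, where the `aᵢ` are the
coefficients of `hornerPoly [a₀, …, a_{d-1}]`, the leading coefficient included. -/
def hornerWord {G : Type*} [Group G] (x c : G) : List ℕ → G
  | [] => c
  | a :: l => c ^ a * (x * hornerWord x c l * x⁻¹)

theorem map_hornerWord {G H : Type*} [Group G] [Group H] (f : G →* H) (x c : G) (l : List ℕ) :
    f (hornerWord x c l) = hornerWord (f x) (f c) l := by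
  induction l with
  | nil => rfl
  | cons a l ih => simp [hornerWord, ih]

theorem hornerWord_laurentAffine (x : LaurentAffine) {c : LaurentAffine} (hc : c.exp = 0)
    (l : List ℕ) :
    (hornerWord x c l).trans = aeval (T x.exp : ℤ[T;T⁻¹]) (hornerPoly l) * c.trans ∧
      (hornerWord x c l).exp = 0 := by
  induction l with
  | nil => simp [hornerWord, hornerPoly, hc]
  | cons a l ih =>
    obtain ⟨h1, h2⟩ := ih
    obtain ⟨h3, h4⟩ := LaurentAffine.pow_of_exp_eq_zero hc a
    have hT : (T x.exp * T (-x.exp) : ℤ[T;T⁻¹]) = 1 := by rw [← T_add, add_neg_cancel, T_zero]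
    constructor
    · simp only [hornerWord, hornerPoly, LaurentAffine.trans_mul, LaurentAffine.exp_mul, h1, h2, h3,
        h4, LaurentAffine.trans_inv, T_zero, add_zero, map_add, map_mul, map_natCast, aeval_X]
      linear_combination (-x.trans) * hT
    · simp [hornerWord, h2, h4]

theorem monic_hornerPoly (l : List ℕ) :
    (hornerPoly l).Monic ∧ (hornerPoly l).natDegree = l.length := by
  induction l with
  | nil => simp [hornerPoly]
  | cons a l ih =>
    obtain ⟨h1, h2⟩ := ih
    have hm : (X * hornerPoly l).Monic := monic_X.mul h1
    have hd : (X * hornerPoly l).natDegree = l.length + 1 := by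
      rw [monic_X.natDegree_mul h1, h2, natDegree_X, add_comm]
    have hlt : degree (a : ℤ[X]) < degree (X * hornerPoly l) := by
      refine lt_of_le_of_lt (degree_natCast_le a) ?_
      rw [degree_eq_natDegree hm.ne_zero, hd]
      exact_mod_cast Nat.succ_pos _
    refine ⟨hm.add_of_right hlt, ?_⟩
    rw [hornerPoly, natDegree_add_eq_right_of_degree_lt hlt, hd, List.length_cons]

theorem one_le_eval_one_hornerPoly (l : List ℕ) : 1 ≤ (hornerPoly l).eval 1 := by
  induction l with
  | nil => simp [hornerPoly]
  | cons a l ih => simp [hornerPoly]; omega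

theorem coeff_zero_hornerPoly_cons (a : ℕ) (l : List ℕ) : (hornerPoly (a :: l)).coeff 0 = a := by
  simp [hornerPoly]

theorem hornerPoly_injective : Function.Injective hornerPoly := by
  intro l l' h
  have hlen : l.length = l'.length := by
    rw [← (monic_hornerPoly l).2, ← (monic_hornerPoly l').2, h]
  induction l generalizing l' with
  | nil => exact (List.length_eq_zero_iff.mp hlen.symm).symm
  | cons a l ih =>
    cases l' with
    | nil => simp at hlen
    | cons b l' =>
      have hab : a = b := by
        have := congrArg (fun p => coeff p 0) h
        simp only [coeff_zero_hornerPoly_cons] at this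
        exact_mod_cast this
      subst hab
      rw [ih (mul_left_cancel₀ X_ne_zero (add_left_cancel h)) (by simpa using hlen)]

/-! ### Rigidity of the polynomials -/

theorem aeval_T_natCast (m : ℕ) (p : ℤ[X]) :
    aeval (T m : ℤ[T;T⁻¹]) p = toLaurent (expand ℤ m p) := by
  have h : (aeval (T m : ℤ[T;T⁻¹]) : ℤ[X] →ₐ[ℤ] ℤ[T;T⁻¹]) = toLaurentAlg.comp (expand ℤ m) := by
    apply Polynomial.algHom_ext
    simp
  rw [h]
  simp

/-- The polynomial `P(X⁻ᵐ)` becomes, after multiplication by a power of `X`, the reverse of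
`P(Xᵐ)`. -/
theorem aeval_T_neg_natCast (m : ℕ) (p : ℤ[X]) :
    aeval (T (-m) : ℤ[T;T⁻¹]) p * T (expand ℤ m p).natDegree =
      toLaurent (expand ℤ m p).reverse := by
  rw [toLaurent_reverse, ← aeval_T_natCast, ← invert_T, aeval_algHom_apply]

/-- A polynomial that vanishes neither at `0` nor at `1` and divides `(T - 1) q(T)` in the Laurent
polynomials already divides `q` in the polynomials. -/
theorem dvd_of_toLaurent_mul_eq {E q : ℤ[X]} (h0 : E.coeff 0 ≠ 0) (h1 : E.eval 1 ≠ 0)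
    {e : ℤ[T;T⁻¹]} {n : ℤ} (h : toLaurent E * e = toLaurent ((X - 1) * q) * T n) : E ∣ q := by
  obtain ⟨N, f, hf⟩ := exists_T_pow (e * T (-n))
  have key : E * f = X ^ N * ((X - 1) * q) := by
    apply toLaurent_injective
    rw [map_mul, hf, map_mul, toLaurent_X_pow]
    have hT : (T n * T (-n) : ℤ[T;T⁻¹]) = 1 := by rw [← T_add, add_neg_cancel, T_zero]
    linear_combination (T (-n) * T N) * h + (toLaurent ((X - 1) * q) * T N) * hT
  have hX : X ^ N ∣ f :=
    (prime_X.pow_dvd_of_dvd_mul_left N (by rwa [X_dvd_iff]) (by rw [key]; exact dvd_mul_right _ _))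
  obtain ⟨g, rfl⟩ := hX
  have hg : E * g = (X - 1) * q :=
    mul_left_cancel₀ (pow_ne_zero N X_ne_zero) (by rw [← key]; ring)
  have hroot : (X - Polynomial.C 1 : ℤ[X]) ∣ g := by
    rw [dvd_iff_isRoot, IsRoot.def]
    have := congrArg (eval 1) hg
    simpa [h1] using this
  obtain ⟨u, rfl⟩ := hroot
  refine ⟨u, (mul_left_cancel₀ (X_sub_C_ne_zero (1 : ℤ)) ?_).symm⟩
  rw [Polynomial.C_1] at hg ⊢
  rw [← hg]
  ring

theorem not_dvd_monic_of_one_lt_leadingCoeff {E q : ℤ[X]} (hq : q.Monic)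
    (hE : 1 < E.leadingCoeff) : ¬ E ∣ q := by
  rintro ⟨u, rfl⟩
  have h : E.leadingCoeff * u.leadingCoeff = 1 := by rw [← leadingCoeff_mul]; exact hq
  have := Int.le_of_dvd one_pos (Dvd.intro _ h)
  omega

/-- Monic polynomials `p` and `q` of the same positive degree coincide as soon as `p(Tᵏ)` divides
`(T - 1) q(T)` over the Laurent polynomials for some integer `k`, provided that `p(0)` and `p(1)` are
at least `2`; this excludes `k < 0` and `k = 0` respectively. -/
theorem eq_of_aeval_T_mul_eq {p q : ℤ[X]} (hp : p.Monic) (hq : q.Monic)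
    (hpq : p.natDegree = q.natDegree) (hpos : 0 < p.natDegree) (h0 : 1 < p.coeff 0)
    (h1 : 1 < p.eval 1) {k : ℤ} {e : ℤ[T;T⁻¹]}
    (h : aeval (T k : ℤ[T;T⁻¹]) p * e = toLaurent ((X - 1) * q)) : p = q := by
  have hE1 : ∀ m, (expand ℤ m p).eval 1 = p.eval 1 := fun m => by simp [expand_eval]
  -- The case `k = 0` is separate: `p(X⁰)` is the constant `p(1)`.
  rcases eq_or_ne k 0 with rfl | hk
  · refine absurd (dvd_of_toLaurent_mul_eq (E := Polynomial.C (p.eval 1)) (q := q) (n := 0) (e := e) ?_ ?_ ?_)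
      (not_dvd_monic_of_one_lt_leadingCoeff hq (by rwa [leadingCoeff_C]))
    · rw [coeff_C_zero]; omega
    · rw [eval_C]; omega
    · rw [T_zero, mul_one, ← h]
      have := aeval_T_natCast 0 p
      rw [expand_zero] at this
      rw [← this]
      simp
  obtain ⟨m, rfl | rfl⟩ := k.eq_nat_or_neg
  · have hm : 0 < m := by omega
    rw [aeval_T_natCast] at h
    have hdvd : expand ℤ m p ∣ q := by
      refine dvd_of_toLaurent_mul_eq (n := 0) (e := e) ?_ ?_ (by rw [T_zero, mul_one, h])
      · rw [← zero_mul m, coeff_expand_mul hm]; omega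
      · rw [hE1]; omega
    have hdeg := natDegree_le_of_dvd hdvd hq.ne_zero
    rw [natDegree_expand, ← hpq] at hdeg
    have hm1 : m = 1 := by nlinarith
    rw [hm1, expand_one] at hdvd
    exact (eq_of_monic_of_dvd_of_natDegree_le hp hq hdvd hpq.ge).symm
  · have hm : 0 < m := by omega
    have hc : (expand ℤ m p).coeff 0 = p.coeff 0 := by
      rw [← zero_mul m, coeff_expand_mul hm, zero_mul]
    have hne : (expand ℤ m p).coeff 0 ≠ 0 := by omega
    refine absurd (dvd_of_toLaurent_mul_eq (E := (expand ℤ m p).reverse) (q := q)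
      (n := (expand ℤ m p).natDegree) (e := e) ?_ ?_ ?_)
      (not_dvd_monic_of_one_lt_leadingCoeff hq ?_)
    · rw [coeff_zero_reverse, leadingCoeff_expand hm, hp.leadingCoeff]; exact one_ne_zero
    · let _ : Invertible (1 : ℤ) := invertibleOne
      have := eval₂_reverse_mul_pow (RingHom.id ℤ) 1 (expand ℤ m p)
      simp only [invOf_one, one_pow, mul_one] at this
      change eval 1 _ = eval 1 _ at this
      rw [this, hE1]; omega
    · rw [← aeval_T_neg_natCast, ← h]; ring
    · rw [reverse_leadingCoeff, trailingCoeff, natTrailingDegree_eq_zero.mpr (Or.inr hne), hc]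
      exact h0

/-! ### Separation of orbits in the free group -/

/-- The words of polynomials with constant coefficient `2` and fixed positive degree are separated
even by the endomorphisms of the free group. -/
theorem eq_of_map_hornerWord_eq {F ι : Type*} [Group F] (B : FreeGroupBasis ι F) {i j : ι}
    (hij : i ≠ j) (σ : F →* F) {l l' : List ℕ} (hlen : l.length = l'.length)
    (h : σ (hornerWord (B i) ⁅B i, B j⁆ (2 :: l)) = hornerWord (B i) ⁅B i, B j⁆ (2 :: l')) :
    l = l' := by
  classical
  let φ : F →* LaurentAffine :=
    B.lift fun t => if t = i then ⟨0, 1⟩ else if t = j then ⟨1, 0⟩ else 1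
  have hi : φ (B i) = ⟨0, 1⟩ := by simp [φ]
  have hj : φ (B j) = ⟨1, 0⟩ := by simp [φ, hij.symm]
  have h' := congrArg (fun g => (φ g).trans) h
  simp only [← MonoidHom.comp_apply φ σ] at h'
  simp only [map_hornerWord, map_commutatorElement] at h'
  rw [(hornerWord_laurentAffine _ (LaurentAffine.exp_commutator _ _) _).1,
    (hornerWord_laurentAffine _ (LaurentAffine.exp_commutator _ _) _).1, hi, hj] at h'
  have hpoly : hornerPoly (2 :: l) = hornerPoly (2 :: l') := by
    have hd := (monic_hornerPoly (2 :: l)).2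
    refine eq_of_aeval_T_mul_eq (monic_hornerPoly _).1 (monic_hornerPoly _).1 ?_ ?_ ?_ ?_
      (h'.trans ?_)
    · rw [hd, (monic_hornerPoly _).2, List.length_cons, List.length_cons, hlen]
    · rw [hd, List.length_cons]; omega
    · rw [coeff_zero_hornerPoly_cons]; norm_num
    · have := one_le_eval_one_hornerPoly l
      simp only [hornerPoly, eval_add, eval_mul, eval_X, eval_natCast]
      push_cast
      omega
    · have := aeval_T_natCast 1 (hornerPoly (2 :: l'))
      rw [expand_one, Nat.cast_one] at this
      rw [this, mul_comm, map_mul]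
      congr 1
      simp [commutatorElement_def, sub_eq_add_neg]
  exact (List.cons.inj (hornerPoly_injective hpoly)).2

theorem exists_ne_of_not_commute {F ι : Type*} [Group F] (B : FreeGroupBasis ι F)
    (hF : ∃ x y : F, x * y ≠ y * x) : ∃ i j : ι, i ≠ j := by
  by_contra! hι
  obtain ⟨x, y, hxy⟩ := hF
  have hconj : ∀ g : F, (∀ i, g * B i = B i * g) → ∀ z, g * z = z * g := by
    intro g hg z
    have := B.ext_hom (MulAut.conj g).toMonoidHom (MonoidHom.id F)
      (fun i => by simp [MulAut.conj_apply, hg i])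
    have := DFunLike.congr_fun this z
    simpa [MulAut.conj_apply, mul_inv_eq_iff_eq_mul] using this
  have hcentral : ∀ i z, B i * z = z * B i := fun i => hconj (B i) fun j => by rw [hι i j]
  exact hxy (hconj x (fun i => (hcentral i x).symm) y)

/-! ### Counting orbits by length -/

section Length

variable {G : Type*} [Group G] {S : Set G}

theorem wordLength_mul_le (hS : Subgroup.closure S = ⊤) (g h : G) :
    wordLength S (g * h) ≤ wordLength S g + wordLength S h :=
  Nat.sInf_le (by
    rw [Set.mem_ofPred_eq, pow_add]
    exact Set.mul_mem_mul (mem_pow_wordLength hS g) (mem_pow_wordLength hS h))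

theorem exists_wordLength_hornerWord_le (hS : Subgroup.closure S = ⊤) (x c : G) (M : ℕ) :
    ∃ K : ℕ, ∀ l : List ℕ, (∀ a ∈ l, a ≤ M) →
      wordLength S (hornerWord x c l) ≤ K * (l.length + 1) := by
  let A := ∑ a ∈ Finset.range (M + 1), wordLength S (c ^ a)
  refine ⟨wordLength S c + (A + wordLength S x + wordLength S x⁻¹), fun l hl => ?_⟩
  induction l with
  | nil => simp [hornerWord]
  | cons a l ih =>
    rw [List.forall_mem_cons] at hl
    have hA : wordLength S (c ^ a) ≤ A :=
      Finset.single_le_sum (f := fun a => wordLength S (c ^ a)) (fun _ _ => Nat.zero_le _)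
        (Finset.mem_range.mpr (Nat.lt_succ_of_le hl.1))
    have h1 := wordLength_mul_le hS (c ^ a) (x * hornerWord x c l * x⁻¹)
    have h2 := wordLength_mul_le hS (x * hornerWord x c l) x⁻¹
    have h3 := wordLength_mul_le hS x (hornerWord x c l)
    have h4 := ih hl.2
    rw [hornerWord, List.length_cons, mul_add _ (l.length + 1)]
    omega

theorem orbitLength_mk_le (Ω : Subgroup (MulAut G)) (g : G) :
    orbitLength S (Quotient.mk'' g : Orbits Ω) ≤ wordLength S g :=
  Nat.sInf_le (Set.mem_image_of_mem _ (MulAction.orbitRel.Quotient.mem_orbit.mpr rfl))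

theorem exists_wordLength_le_of_orbitLength_le {Ω : Subgroup (MulAut G)} {o : Orbits Ω} {n : ℕ}
    (ho : orbitLength S o ≤ n) : ∃ g : G, Quotient.mk'' g = o ∧ wordLength S g ≤ n := by
  obtain ⟨g, hg, hgl⟩ := Nat.sInf_mem
    ((MulAction.orbitRel.Quotient.nonempty_orbit o).image (wordLength S))
  exact ⟨g, MulAction.orbitRel.Quotient.mem_orbit.mp hg, hgl.trans_le ho⟩

theorem exists_orbitGrowth_le_pow (hfin : S.Finite) (hS : Subgroup.closure S = ⊤)
    (Ω : Subgroup (MulAut G)) : ∃ K : ℕ, ∀ n, orbitGrowth Ω S n ≤ K ^ n := by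
  classical
  -- Adjoining `1` makes the powers of the set contain the balls.
  let U : Finset G := insert 1 ((hfin.union hfin.inv).toFinset)
  have hU1 : (1 : G) ∈ U := Finset.mem_insert_self _ _
  have hSU : (S ∪ S⁻¹) ⊆ (U : Set G) := fun g hg => by simp [U]; exact Or.inr (by simpa using hg)
  refine ⟨U.card, fun n => le_trans ?_ (Finset.card_pow_le (s := U) (n := n))⟩
  let f : G → Orbits Ω := Quotient.mk''
  have hsub : {o : Orbits Ω | orbitLength S o ≤ n} ⊆ ((U ^ n).image f : Finset (Orbits Ω)) := by
    intro o ho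
    obtain ⟨g, hg, hgn⟩ := exists_wordLength_le_of_orbitLength_le ho
    rw [Finset.coe_image, Finset.coe_pow]
    refine ⟨g, ?_, hg⟩
    exact Set.pow_subset_pow hSU hU1 hgn (mem_pow_wordLength hS g)
  calc orbitGrowth Ω S n ≤ ((U ^ n).image f).card := by
        rw [← Set.ncard_coe_finset]
        exact Set.ncard_le_ncard hsub (Finset.finite_toSet _)
    _ ≤ (U ^ n).card := Finset.card_image_le

theorem growthLE_two_pow (hfin : S.Finite) (hS : Subgroup.closure S = ⊤)
    (Ω : Subgroup (MulAut G)) : GrowthLE (orbitGrowth Ω S) (fun n => 2 ^ n) := by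
  obtain ⟨K, hK⟩ := exists_orbitGrowth_le_pow hfin hS Ω
  refine ⟨K + 1, Nat.succ_ne_zero _, fun n => ?_⟩
  calc orbitGrowth Ω S n ≤ K ^ n := hK n
    _ ≤ (2 ^ K) ^ n := Nat.pow_le_pow_left Nat.lt_two_pow_self.le n
    _ = 2 ^ (K * n) := (pow_mul 2 K n).symm
    _ ≤ 2 ^ ((K + 1) * n + (K + 1)) := Nat.pow_le_pow_right two_pos (by nlinarith)
    _ ≤ (K + 1) * 2 ^ ((K + 1) * n + (K + 1)) := Nat.le_mul_of_pos_left _ K.succ_pos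
    _ ≤ _ := Nat.le_add_right _ _

end Length

theorem two_pow_growthLE {F ι : Type*} [Group F] (B : FreeGroupBasis ι F) {i j : ι} (hij : i ≠ j)
    {S : Set F} (hfin : S.Finite) (hS : Subgroup.closure S = ⊤) :
    GrowthLE (fun n => 2 ^ n) (automorphicGrowth S) := by
  obtain ⟨K, hK⟩ := exists_wordLength_hornerWord_le hS (B i) ⁅B i, B j⁆ 2
  refine ⟨2 * K + 1, Nat.succ_ne_zero _, fun n => ?_⟩
  let coeffs : (Fin n → Bool) → List ℕ := fun b => List.ofFn fun t => (b t).toNat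
  let f : (Fin n → Bool) → Orbits (⊤ : Subgroup (MulAut F)) := fun b =>
    Quotient.mk'' (hornerWord (B i) ⁅B i, B j⁆ (2 :: coeffs b))
  have hinj : Function.Injective f := by
    intro b b' hbb
    obtain ⟨σ, hσ⟩ := MulAction.orbitRel_apply.mp (Quotient.eq''.mp hbb)
    have := eq_of_map_hornerWord_eq B hij (σ : MulAut F).toMonoidHom
      (by simp [coeffs]) hσ
    funext t
    have := congrFun (List.ofFn_injective this) t
    revert this
    cases b t <;> cases b' t <;> simp
  have hle : ∀ b, orbitLength S (f b) ≤ K * (n + 2) := by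
    intro b
    refine (orbitLength_mk_le _ _).trans ((hK (2 :: coeffs b) ?_).trans ?_)
    · rw [List.forall_mem_cons]
      refine ⟨le_rfl, fun a ha => ?_⟩
      obtain ⟨t, rfl⟩ := (List.mem_ofFn' _ _).mp ha
      exact (Bool.toNat_le _).trans one_le_two
    · simp [coeffs]
  have hcount : 2 ^ n ≤ automorphicGrowth S (K * (n + 2)) := by
    calc 2 ^ n = (Set.range f).ncard := by
          rw [← Set.image_univ, Set.ncard_image_of_injective _ hinj, Set.ncard_univ]
          simp
      _ ≤ _ := Set.ncard_le_ncard (Set.range_subset_iff.mpr hle) (finite_orbits hfin hS _ _)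
  have hmono : automorphicGrowth S (K * (n + 2)) ≤
      automorphicGrowth S ((2 * K + 1) * n + (2 * K + 1)) :=
    orbitGrowth_mono hfin hS _ (by nlinarith)
  calc 2 ^ n ≤ automorphicGrowth S ((2 * K + 1) * n + (2 * K + 1)) := hcount.trans hmono
    _ ≤ (2 * K + 1) * automorphicGrowth S ((2 * K + 1) * n + (2 * K + 1)) :=
        Nat.le_mul_of_pos_left _ (Nat.succ_pos _)
    _ ≤ _ := Nat.le_add_right _ _

end AutGrowth

theorem mainTheorem3 {F : Type*} [Group F] {ι : Type*} [Finite ι] (B : FreeGroupBasis ι F)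
    (hF : ∃ x y : F, x * y ≠ y * x)
    (S : Set F) (hfin : S.Finite) (hS : Subgroup.closure S = ⊤) :
    AutGrowth.IsExponentialGrowth (AutGrowth.automorphicGrowth S) := by
  obtain ⟨i, j, hij⟩ := AutGrowth.exists_ne_of_not_commute B hF
  exact ⟨AutGrowth.growthLE_two_pow hfin hS _, AutGrowth.two_pow_growthLE B hij hfin hS⟩
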